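/- Let $Q$ be a finite alphabet of size $q\ge 2$, let $T$ be the left shift on $Q^{\mathbb Z}$, $(Tx)_j=x_{j+1}$, and write $[n]=\{0,1,\dots,n-1\}$. For a $T$-invariant Borel probability measure $\mu$ on $Q^{\mathbb Z}$ let $X=(X_i)_{i\in\mathbb Z}$ denote the coordinate process under $\mu$, and let $$h(\mu)=\lim_{n\to\infty}\frac1n H_\mu(X_0,\dots,X_{n-1}),$$ where all Shannon entropies are taken with logarithms to the base $q$. For integers $k,l\ge 1$ and $\epsilon>0$ the measure $\mu$ is called $(\epsilon,k,l)$-recoverable if it is a $T$-invariant Borel probability measure and, for all $\alpha,\beta\in Q^l$ such that the event $\{X_{[l]}=\alpha,\;X_{l+k+[l]}=\beta\}$ has positive probability, $$H_\mu\bigl(X_{l+[k]}\;\big|\;X_{[l]}=\alpha,\;X_{l+k+[l]}=\beta\bigr)\le\epsilon,$$ i.e. the Shannon entropy of the conditional law of $X_{l+[k]}$ given this event is at most $\epsilon$. Put $$h_q^*(\epsilon,k,l)=\max\{h(\mu):\ \mu \text{ is } (\epsilon,k,l)\text{-recoverable}\}.$$ **Proposition.** Let $k,l\ge1$ be integers and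 let $\epsilon_1>\epsilon_2>0$ be real numbers with $\epsilon_2<k$. Then the maxima $h_q^*(\epsilon_1,k,l)$ and $h_q^*(\epsilon_2,k,l)$ are attained, and $$h_q^*(\epsilon_1,k,l)>h_q^*(\epsilon_2,k,l).$$ -/

import Mathlib

open MeasureTheory Filter Topology

noncomputable section

namespace RecSys

/-- The left shift `T` on bi-infinite sequences, `(T x)_j = x_{j+1}`. -/
def shift {Q : Type*} (x : ℤ → Q) : ℤ → Q := fun j => x (j + 1)

/-- The word `x_{a+[n]} = (x_a, …, x_{a+n-1})`. -/
def window {Q : Type*} (a : ℤ) (n : ℕ) (x : ℤ → Q) : Fin n → Q := fun i => x (a + (i : ℕ))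

/-- Shannon entropy, with logarithms to the base `b` and `0 log 0 = 0`, of a distribution `ν` on a
finite set `A`. -/
def shannonEntropy (b : ℝ) {A : Type*} [Fintype A] [MeasurableSpace A] (ν : Measure A) : ℝ :=
  -∑ a, ν.real {a} * Real.logb b (ν.real {a})

section Measures

variable {Q : Type*} [Fintype Q] [MeasurableSpace Q]

/-- `H_μ([n])`: the Shannon entropy, to the base `q = |Q|`, of the law of `X_0 … X_{n-1}`. -/
def blockEntropy (μ : Measure (ℤ → Q)) (n : ℕ) : ℝ :=
  shannonEntropy (Fintype.card Q : ℝ) (μ.map (window 0 n))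

/-- The entropy `h(μ) = lim_n (1/n) H_μ([n])`. -/
def entropy (μ : Measure (ℤ → Q)) : ℝ :=
  limUnder atTop fun n : ℕ => blockEntropy μ n / n

/-- `H_μ(X_{l+[k]} | X_{[l]} = α, X_{l+k+[l]} = β)`: the Shannon entropy, to the base `q = |Q|`, of
the law of `X_{l+[k]}` conditional on the event `X_{[l]} = α, X_{l+k+[l]} = β`. If the event has
probability zero, then `ProbabilityTheory.cond` is the zero measure and the value is `0`. -/
def condEntropy (μ : Measure (ℤ → Q)) (k l : ℕ) (α β : Fin l → Q) : ℝ :=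
  shannonEntropy (Fintype.card Q : ℝ)
    ((ProbabilityTheory.cond μ {x | window 0 l x = α ∧ window ((l : ℤ) + k) l x = β}).map
      (window (l : ℤ) k))

/-- `μ` is an `(ε, k, l)`-recoverable measure on `Q^ℤ`. -/
structure IsRecoverable (ε : ℝ) (k l : ℕ) (μ : Measure (ℤ → Q)) : Prop where
  isProbabilityMeasure : IsProbabilityMeasure μ
  shiftInvariant : MeasurePreserving (shift (Q := Q)) μ μ
  condEntropy_le : ∀ α β : Fin l → Q, condEntropy μ k l α β ≤ ε

end Measures

/-- The set of all entropies `h(μ)` of `(ε, k, l)`-recoverable measures `μ` on `Q^ℤ`. -/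
def entropyValues (Q : Type*) [Fintype Q] [MeasurableSpace Q] (ε : ℝ) (k l : ℕ) : Set ℝ :=
  {h | ∃ μ : Measure (ℤ → Q), IsRecoverable ε k l μ ∧ entropy μ = h}

/-- `h*_q(ε, k, l)`, the largest entropy of an `(ε, k, l)`-recoverable measure, as a supremum. -/
def maxEntropy (Q : Type*) [Fintype Q] [MeasurableSpace Q] (ε : ℝ) (k l : ℕ) : ℝ :=
  sSup (entropyValues Q ε k l)

end RecSys

end

/-! Recoverability constrains only the law `p` of words of length `d + 1 = l + k + l`. Among
stationary measures with this word law, the entropy is at most `rate p`, the conditional entropy of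
the last letter given the preceding `d` (`entropy_le_rate`), and the `d`-step Markov measure built
from `p` attains this bound (`IsStationaryLaw.exists_measure`). Thus the problem is to maximise the
continuous function `rate` over the compact set of feasible laws (`isCompact_isFeasible`), which
gives attainment.

For strictness, take a feasible law `p` for the smaller bound and mix in a little of another law
`r`. The feasible set is not convex in general, but each outer pair of positive probability has
slack, which survives a small perturbation; on a null pair only `r` contributes, and it must satisfy
the constraint itself (`eventually_isFeasible_mix`). Two cases arise (`exists_isFeasible_rate_lt`).
If an allowed prefix has a forbidden continuation, `r` is a fully supported product law of small
entropy: the infinite slope of `-x log x` at `0` yields a gain of order `δ log (1/δ)`, against a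
loss of order `δ`. Otherwise stationarity forces full support, the hypothesis `ε₂ < k` excludes the
uniform law, so `rate p < log q`, and mixing in the uniform law raises the rate by concavity.

Entropies are unnormalised, in nats and homogeneous of degree one, so no division by the probability
of a conditioning event occurs in the constraints. -/

noncomputable section

namespace RecSys

/-! ### Homogeneous entropy: concavity and the logarithmic bound. -/

section HomEntropy

variable {A : Type*} [Fintype A]

/-- The perspective `a log (b / a)` of the function `log`, with `0 log 0 = 0`. -/
def entropyTerm (a b : ℝ) : ℝ := Real.negMulLog a + a * Real.log b

/-- The entropy of a nonnegative vector, homogeneous of degree one: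
`∑ f log (S / f)` with `S = ∑ f`. -/
def homEntropy (f : A → ℝ) : ℝ := ∑ a, Real.negMulLog (f a) - Real.negMulLog (∑ a, f a)

lemma homEntropy_eq_sum_entropyTerm (f : A → ℝ) :
    homEntropy f = ∑ a, entropyTerm (f a) (∑ b, f b) := by
  simp only [homEntropy, entropyTerm, Finset.sum_add_distrib, ← Finset.sum_mul, Real.negMulLog]
  ring

lemma entropyTerm_mul (c a b : ℝ) :
    entropyTerm (c * a) b = a * Real.negMulLog c + c * entropyTerm a b := by
  simp only [entropyTerm, Real.negMulLog_mul]
  ring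

/-- This is `log x ≤ x - 1` at `x = b c / a`, with equality only for `a = b c`. The bound is linear
in `(a, b)`, so it can be summed; `c` is a guess for the ratio `a / b`. -/
lemma entropyTerm_le {a b c : ℝ} (ha : 0 ≤ a) (hab : a ≤ b) (hc : 0 < c) :
    entropyTerm a b ≤ b * c - a - a * Real.log c := by
  rcases ha.eq_or_lt with rfl | ha
  · simp only [entropyTerm, Real.negMulLog_zero]
    have : 0 ≤ b * c := by positivity
    linarith
  · have hb : 0 < b := ha.trans_le hab
    have h := Real.log_le_sub_one_of_pos (show 0 < b * c / a by positivity)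
    rw [Real.log_div (by positivity) ha.ne', Real.log_mul hb.ne' hc.ne'] at h
    have h2 := mul_le_mul_of_nonneg_left h ha.le
    have h3 : a * (b * c / a - 1) = b * c - a := by field_simp
    rw [h3] at h2
    simp only [entropyTerm, Real.negMulLog]
    linarith

lemma entropyTerm_lt {a b c : ℝ} (ha : 0 ≤ a) (hab : a ≤ b) (hc : 0 < c) (hne : a ≠ b * c) :
    entropyTerm a b < b * c - a - a * Real.log c := by
  rcases ha.eq_or_lt with rfl | ha
  · simp only [entropyTerm, Real.negMulLog_zero]
    have : 0 ≤ b * c := by positivity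
    have := lt_of_le_of_ne this hne
    linarith
  · have hb : 0 < b := ha.trans_le hab
    have hne' : b * c / a ≠ 1 := by
      intro h
      rw [div_eq_one_iff_eq ha.ne'] at h
      exact hne h.symm
    have h := Real.log_lt_sub_one_of_pos (show 0 < b * c / a by positivity) hne'
    rw [Real.log_div (by positivity) ha.ne', Real.log_mul hb.ne' hc.ne'] at h
    have h2 := mul_lt_mul_of_pos_left h ha
    have h3 : a * (b * c / a - 1) = b * c - a := by field_simp
    rw [h3] at h2
    simp only [entropyTerm, Real.negMulLog]
    linarith

/-- The log-sum inequality: the tangent bound at the common ratio `c = (a + a') / (b + b')` is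
linear and exact for the summed pair. -/
lemma entropyTerm_add_le {a b a' b' : ℝ} (ha : 0 ≤ a) (hab : a ≤ b) (ha' : 0 ≤ a')
    (hab' : a' ≤ b') : entropyTerm a b + entropyTerm a' b' ≤ entropyTerm (a + a') (b + b') := by
  rcases (add_nonneg ha ha').eq_or_lt with h0 | hpos
  · have h1 : a = 0 := by linarith
    have h2 : a' = 0 := by linarith
    simp [h1, h2, entropyTerm]
  · have hB : 0 < b + b' := by linarith
    have hc : 0 < (a + a') / (b + b') := by positivity
    have h1 := entropyTerm_le ha hab hc
    have h2 := entropyTerm_le ha' hab' hc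
    have h3 : (b + b') * ((a + a') / (b + b')) = a + a' := by field_simp
    rw [Real.log_div hpos.ne' hB.ne'] at h1 h2
    have h4 : entropyTerm (a + a') (b + b') =
        (b + b') * ((a + a') / (b + b')) - a - a'
          - (a + a') * (Real.log (a + a') - Real.log (b + b')) := by
      rw [h3]
      simp only [entropyTerm, Real.negMulLog]
      ring
    rw [h4]
    linarith

lemma entropyTerm_mul_mul {c a b : ℝ} (hc : c ≠ 0) (hb : b = 0 → a = 0) :
    entropyTerm (c * a) (c * b) = c * entropyTerm a b := by
  by_cases h : b = 0
  · simp [hb h, entropyTerm]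
  · have hlog : Real.negMulLog c = -c * Real.log c := rfl
    simp only [entropyTerm, Real.negMulLog_mul, Real.log_mul hc h, hlog]
    ring

lemma entropyTerm_mono {a b b' : ℝ} (ha : 0 ≤ a) (hb : 0 < b) (h : b ≤ b') :
    entropyTerm a b ≤ entropyTerm a b' := by
  unfold entropyTerm
  gcongr

lemma continuous_homEntropy : Continuous (homEntropy : (A → ℝ) → ℝ) := by
  unfold homEntropy
  have := Real.continuous_negMulLog
  fun_prop

lemma homEntropy_mul (c : ℝ) (f : A → ℝ) :
    homEntropy (fun a => c * f a) = c * homEntropy f := by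
  simp only [homEntropy, ← Finset.mul_sum, Real.negMulLog_mul, Finset.sum_add_distrib,
    ← Finset.sum_mul]
  ring

lemma homEntropy_add_le {f g : A → ℝ} (hf : ∀ a, 0 ≤ f a) (hg : ∀ a, 0 ≤ g a) :
    homEntropy f + homEntropy g ≤ homEntropy (fun a => f a + g a) := by
  simp only [homEntropy_eq_sum_entropyTerm, ← Finset.sum_add_distrib]
  refine Finset.sum_le_sum fun a _ => ?_
  rw [Finset.sum_add_distrib]
  exact entropyTerm_add_le (hf a)
    (Finset.single_le_sum (fun i _ => hf i) (Finset.mem_univ a)) (hg a)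
    (Finset.single_le_sum (fun i _ => hg i) (Finset.mem_univ a))

/-- Conditioning reduces entropy, in unnormalised form: forgetting `b` merges the vectors `f b`. -/
lemma sum_homEntropy_le {B : Type*} (s : Finset B) {f : B → A → ℝ} (hf : ∀ b a, 0 ≤ f b a) :
    ∑ b ∈ s, homEntropy (f b) ≤ homEntropy (fun a => ∑ b ∈ s, f b a) := by
  classical
  induction s using Finset.induction_on with
  | empty => simp [homEntropy]
  | insert b s hb ih =>
    simp only [Finset.sum_insert hb]
    exact (add_le_add_right ih _).trans
      (homEntropy_add_le (hf b) fun a => Finset.sum_nonneg fun i _ => hf i a)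

lemma homEntropy_nonneg {f : A → ℝ} (hf : ∀ a, 0 ≤ f a) : 0 ≤ homEntropy f := by
  rw [homEntropy_eq_sum_entropyTerm]
  refine Finset.sum_nonneg fun a _ => ?_
  rcases (hf a).eq_or_lt with h | h
  · simp [← h, entropyTerm]
  · have := Real.log_le_log h (Finset.single_le_sum (fun i _ => hf i) (Finset.mem_univ a))
    have := mul_le_mul_of_nonneg_left this h.le
    simp only [entropyTerm, Real.negMulLog]
    linarith

/-- The tangent bounds at the uniform ratio `c = 1 / |A|` add up to the logarithmic bound;
strictness at a single letter then gives `homEntropy_lt`. -/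
lemma sum_tangent [Nonempty A] (f : A → ℝ) :
    ∑ a, ((∑ b, f b) * (Fintype.card A : ℝ)⁻¹ - f a - f a * Real.log (Fintype.card A : ℝ)⁻¹)
      = (∑ a, f a) * Real.log (Fintype.card A) := by
  have : (Fintype.card A : ℝ) ≠ 0 := by simp
  simp only [Finset.sum_sub_distrib, ← Finset.sum_mul, Real.log_inv, Finset.sum_const,
    Finset.card_univ, nsmul_eq_mul]
  field_simp
  ring

lemma homEntropy_le [Nonempty A] {f : A → ℝ} (hf : ∀ a, 0 ≤ f a) :
    homEntropy f ≤ (∑ a, f a) * Real.log (Fintype.card A) := by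
  rw [homEntropy_eq_sum_entropyTerm, ← sum_tangent]
  exact Finset.sum_le_sum fun a _ => entropyTerm_le (hf a)
    (Finset.single_le_sum (fun i _ => hf i) (Finset.mem_univ a)) (by positivity)

lemma homEntropy_lt [Nonempty A] {f : A → ℝ} (hf : ∀ a, 0 ≤ f a) {a b : A} (hab : f a ≠ f b) :
    homEntropy f < (∑ a, f a) * Real.log (Fintype.card A) := by
  rw [homEntropy_eq_sum_entropyTerm, ← sum_tangent]
  have hle : ∀ a, f a ≤ ∑ b, f b := fun a =>
    Finset.single_le_sum (fun i _ => hf i) (Finset.mem_univ a)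
  obtain ⟨x, hx⟩ : ∃ x, f x ≠ (∑ b, f b) * (Fintype.card A : ℝ)⁻¹ := by
    by_contra! h
    exact hab ((h a).trans (h b).symm)
  exact Finset.sum_lt_sum (fun a _ => entropyTerm_le (hf a) (hle a) (by positivity))
    ⟨x, Finset.mem_univ x, entropyTerm_lt (hf x) (hle x) (by positivity) hx⟩

lemma homEntropy_const (c : ℝ) :
    homEntropy (fun _ : A => c) = (∑ _a : A, c) * Real.log (Fintype.card A) := by
  have hlog : Real.negMulLog (Fintype.card A : ℝ)
      = -(Fintype.card A : ℝ) * Real.log (Fintype.card A) := rfl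
  simp only [homEntropy, Finset.sum_const, Finset.card_univ, nsmul_eq_mul, Real.negMulLog_mul,
    hlog]
  ring

end HomEntropy

/-! ### Sums over words by last or first letter. -/

section Words

variable {Q : Type*} [Fintype Q]

lemma sum_word_snoc {M : Type*} [AddCommMonoid M] {m : ℕ} (f : (Fin (m + 1) → Q) → M) :
    ∑ x, f x = ∑ u : Fin m → Q, ∑ a, f (Fin.snoc u a) := by
  rw [← (Fin.snocEquiv (fun _ => Q)).sum_comp, Fintype.sum_prod_type, Finset.sum_comm]
  rfl

lemma sum_word_cons {M : Type*} [AddCommMonoid M] {m : ℕ} (f : (Fin (m + 1) → Q) → M) :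
    ∑ x, f x = ∑ u : Fin m → Q, ∑ a, f (Fin.cons a u) := by
  rw [← (Fin.consEquiv (fun _ => Q)).sum_comp, Fintype.sum_prod_type, Finset.sum_comm]
  rfl

end Words

/-! ### Stationary word laws: concavity of the rate, support and uniformity. -/

section StationaryLaws

variable {Q : Type*} [Fintype Q] {d : ℕ}

/-- The law of the first `d` letters of a random word of length `d + 1`. -/
def prefixLaw (p : (Fin (d + 1) → Q) → ℝ) (u : Fin d → Q) : ℝ := ∑ a, p (Fin.snoc u a)

/-- The entropy of the last letter of a word of length `d + 1` given the preceding ones, in nats. -/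
def rate (p : (Fin (d + 1) → Q) → ℝ) : ℝ := ∑ u : Fin d → Q, homEntropy fun a => p (Fin.snoc u a)

/-- Probability vectors on words of length `d + 1` whose marginals on the first and on the last `d`
letters agree. -/
structure IsStationaryLaw (p : (Fin (d + 1) → Q) → ℝ) : Prop where
  nonneg : ∀ w, 0 ≤ p w
  sum_eq_one : ∑ w, p w = 1
  prefixLaw_eq : ∀ u, prefixLaw p u = ∑ a, p (Fin.cons a u)

lemma continuous_rate : Continuous (rate : ((Fin (d + 1) → Q) → ℝ) → ℝ) := by
  unfold rate
  refine continuous_finsetSum _ fun u _ => continuous_homEntropy.comp ?_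
  fun_prop

lemma isClosed_isStationaryLaw : IsClosed {p : (Fin (d + 1) → Q) → ℝ | IsStationaryLaw p} := by
  have : {p : (Fin (d + 1) → Q) → ℝ | IsStationaryLaw p} =
      {p | ∀ w, 0 ≤ p w} ∩ {p | ∑ w, p w = 1} ∩
        {p | ∀ u, prefixLaw p u = ∑ a, p (Fin.cons a u)} := by
    ext p
    exact ⟨fun h => ⟨⟨h.1, h.2⟩, h.3⟩, fun h => ⟨h.1.1, h.1.2, h.2⟩⟩
  rw [this]
  refine (IsClosed.inter ?_ ?_).inter ?_
  · simp only [Set.ofPred_forall]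
    exact isClosed_iInter fun w => isClosed_le continuous_const (continuous_apply w)
  · exact isClosed_eq (by fun_prop) continuous_const
  · simp only [Set.ofPred_forall, prefixLaw]
    exact isClosed_iInter fun u => isClosed_eq (by fun_prop) (by fun_prop)

lemma rate_eq_sum_entropyTerm (p : (Fin (d + 1) → Q) → ℝ) :
    rate p = ∑ w, entropyTerm (p w) (prefixLaw p (Fin.init w)) := by
  simp only [rate, homEntropy_eq_sum_entropyTerm, prefixLaw, sum_word_snoc, Fin.init_snoc]

lemma IsStationaryLaw.le_prefixLaw {p : (Fin (d + 1) → Q) → ℝ} (hp : ∀ w, 0 ≤ p w)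
    (w : Fin (d + 1) → Q) : p w ≤ prefixLaw p (Fin.init w) := by
  have := Finset.single_le_sum (f := fun a => p (Fin.snoc (Fin.init w) a)) (fun a _ => hp _)
    (Finset.mem_univ (w (Fin.last d)))
  rwa [Fin.snoc_init_self] at this

/-- The convex combination `(1 - δ) p + δ r`. -/
def mix (δ : ℝ) (p r : (Fin (d + 1) → Q) → ℝ) (w : Fin (d + 1) → Q) : ℝ :=
  (1 - δ) * p w + δ * r w

lemma prefixLaw_mix (δ : ℝ) (p r : (Fin (d + 1) → Q) → ℝ) (u : Fin d → Q) :
    prefixLaw (mix δ p r) u = (1 - δ) * prefixLaw p u + δ * prefixLaw r u := by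
  simp only [prefixLaw, mix, Finset.sum_add_distrib, Finset.mul_sum]

lemma IsStationaryLaw.mix {p r : (Fin (d + 1) → Q) → ℝ} (hp : IsStationaryLaw p)
    (hr : IsStationaryLaw r) {δ : ℝ} (h0 : 0 ≤ δ) (h1 : δ ≤ 1) :
    IsStationaryLaw (mix δ p r) where
  nonneg w := add_nonneg (mul_nonneg (by linarith) (hp.nonneg w)) (mul_nonneg h0 (hr.nonneg w))
  sum_eq_one := by
    simp only [RecSys.mix, Finset.sum_add_distrib, ← Finset.mul_sum, hp.sum_eq_one, hr.sum_eq_one]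
    ring
  prefixLaw_eq u := by
    rw [prefixLaw_mix, hp.prefixLaw_eq, hr.prefixLaw_eq]
    simp only [RecSys.mix, Finset.sum_add_distrib, Finset.mul_sum]

/-- Concavity is kept word by word because the gap at one forbidden word is later used alone. -/
lemma entropyTerm_mix_ge {p r : (Fin (d + 1) → Q) → ℝ} (hp : ∀ w, 0 ≤ p w) (hr : ∀ w, 0 ≤ r w)
    {δ : ℝ} (h0 : 0 < δ) (h1 : δ < 1) (w : Fin (d + 1) → Q) :
    (1 - δ) * entropyTerm (p w) (prefixLaw p (Fin.init w))
        + δ * entropyTerm (r w) (prefixLaw r (Fin.init w))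
      ≤ entropyTerm (mix δ p r w) (prefixLaw (mix δ p r) (Fin.init w)) := by
  have key : ∀ {s : (Fin (d + 1) → Q) → ℝ}, (∀ w, 0 ≤ s w) → prefixLaw s (Fin.init w) = 0 →
      s w = 0 := fun hs h =>
    le_antisymm (h ▸ IsStationaryLaw.le_prefixLaw hs w) (hs w)
  have h1' : 0 < 1 - δ := by linarith
  rw [prefixLaw_mix, mix, ← entropyTerm_mul_mul h1'.ne' (key hp),
    ← entropyTerm_mul_mul h0.ne' (key hr)]
  exact entropyTerm_add_le (mul_nonneg h1'.le (hp w))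
    (mul_le_mul_of_nonneg_left (IsStationaryLaw.le_prefixLaw hp w) h1'.le)
    (mul_nonneg h0.le (hr w))
    (mul_le_mul_of_nonneg_left (IsStationaryLaw.le_prefixLaw hr w) h0.le)

lemma rate_mix_ge {p r : (Fin (d + 1) → Q) → ℝ} (hp : ∀ w, 0 ≤ p w) (hr : ∀ w, 0 ≤ r w)
    {δ : ℝ} (h0 : 0 < δ) (h1 : δ < 1) : (1 - δ) * rate p + δ * rate r ≤ rate (mix δ p r) := by
  simp only [rate_eq_sum_entropyTerm, Finset.mul_sum, ← Finset.sum_add_distrib]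
  exact Finset.sum_le_sum fun w _ => entropyTerm_mix_ge hp hr h0 h1 w

/-- Putting mass on a forbidden continuation of an allowed prefix increases the entropy rate, as
the derivative of `-x log x` at `0` is infinite. -/
lemma eventually_rate_lt_rate_mix {p r : (Fin (d + 1) → Q) → ℝ} (hp : ∀ w, 0 ≤ p w)
    (hr : ∀ w, 0 ≤ r w) {w : Fin (d + 1) → Q} (hw : p w = 0)
    (hpre : 0 < prefixLaw p (Fin.init w)) (hrw : 0 < r w) :
    ∀ᶠ δ in 𝓝[>] (0 : ℝ), rate p < rate (mix δ p r) := by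
  set b := prefixLaw p (Fin.init w)
  set b' := prefixLaw r (Fin.init w) with hb'
  -- The gain will be at least `δ * (rate r - rate p + C - r w * log δ)`; for `δ < 1/2` the mixed
  -- prefix mass is at least `b / 2`.
  set C := entropyTerm (r w) (b / 2) - entropyTerm (r w) b'
  have hb'0 : 0 ≤ b' := Finset.sum_nonneg fun a _ => hr _
  have hlog : ∀ᶠ δ in 𝓝[>] (0 : ℝ), Real.log δ < (rate r - rate p + C) / r w :=
    Real.tendsto_log_nhdsGT_zero.eventually_lt_atBot _
  have hhalf : ∀ᶠ δ in 𝓝[>] (0 : ℝ), δ < 1 / 2 :=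
    mem_nhdsWithin_of_mem_nhds (Iio_mem_nhds (by norm_num))
  filter_upwards [hlog, hhalf, self_mem_nhdsWithin] with δ h1 h2 h0
  have h0 : 0 < δ := h0
  rw [lt_div_iff₀ hrw] at h1
  -- Every word contributes a nonnegative concavity gap, so the gap at `w` bounds the total from
  -- below.
  have hD : entropyTerm (mix δ p r w) (prefixLaw (mix δ p r) (Fin.init w))
      - ((1 - δ) * entropyTerm (p w) b + δ * entropyTerm (r w) b')
      ≤ rate (mix δ p r) - ((1 - δ) * rate p + δ * rate r) := by
    simp only [rate_eq_sum_entropyTerm, Finset.mul_sum, ← Finset.sum_add_distrib,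
      ← Finset.sum_sub_distrib]
    exact Finset.single_le_sum (f := fun w => entropyTerm (mix δ p r w)
        (prefixLaw (mix δ p r) (Fin.init w)) -
        ((1 - δ) * entropyTerm (p w) (prefixLaw p (Fin.init w))
        + δ * entropyTerm (r w) (prefixLaw r (Fin.init w))))
      (fun v _ => sub_nonneg.2 (entropyTerm_mix_ge hp hr h0 (by linarith) v)) (Finset.mem_univ w)
  rw [prefixLaw_mix, mix, hw, mul_zero, zero_add, entropyTerm_mul] at hD
  have hmono : entropyTerm (r w) (b / 2) ≤ entropyTerm (r w) ((1 - δ) * b + δ * b') := by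
    refine entropyTerm_mono hrw.le (by positivity) ?_
    nlinarith [mul_nonneg h0.le hb'0]
  have h0' : entropyTerm 0 b = 0 := by simp [entropyTerm]
  rw [h0', mul_zero, zero_add] at hD
  have hmul := mul_le_mul_of_nonneg_left hmono h0.le
  have hneg : Real.negMulLog δ = -δ * Real.log δ := rfl
  rw [hneg] at hD
  have hfin : 0 < δ * ((rate r - rate p + C) - Real.log δ * r w) :=
    mul_pos h0 (by linarith)
  simp only [C] at hfin
  nlinarith

/-- A stationary law without forbidden continuations has full support. -/
lemma IsStationaryLaw.pos {p : (Fin (d + 1) → Q) → ℝ} (hp : IsStationaryLaw p)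
    (h : ∀ w, 0 < prefixLaw p (Fin.init w) → 0 < p w) (v : Fin (d + 1) → Q) : 0 < p v := by
  obtain ⟨w, -, hw⟩ : ∃ w ∈ Finset.univ, 0 < p w :=
    Finset.exists_lt_of_sum_lt (f := fun _ => (0 : ℝ)) (by simp [hp.sum_eq_one])
  -- The sequence reads `w`, then `v`; beyond these `2 (d + 1)` letters its values play no role.
  let x : ℕ → Q := fun i =>
    if hi : i < d + 1 then w ⟨i, hi⟩ else v ⟨(i - (d + 1)) % (d + 1), Nat.mod_lt _ d.succ_pos⟩
  -- A window slides from `w` to `v`: by stationarity the tail of an allowed word is an allowed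
  -- prefix, and `h` allows every continuation.
  have hstep : ∀ i : ℕ, 0 < p fun j : Fin (d + 1) => x (i + j) := by
    intro i
    induction i with
    | zero =>
      convert hw using 2
      ext j
      have hj := j.2
      simp only [x, zero_add, hj, dif_pos]
    | succ i ih =>
      apply h
      rw [hp.prefixLaw_eq]
      refine ih.trans_le ?_
      have hle := Finset.single_le_sum
        (f := fun a => p (Fin.cons a (Fin.init fun j : Fin (d + 1) => x (i + 1 + j))))
        (fun a _ => hp.nonneg _) (Finset.mem_univ (x i))
      convert hle using 2
      ext j
      refine Fin.cases ?_ (fun j => ?_) j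
      · simp
      · simp only [Fin.val_succ, Fin.cons_succ, Fin.init, Fin.val_castSucc]
        congr 1
        omega
  convert hstep (d + 1) using 2
  ext j
  have hj : ¬ d + 1 + (j : ℕ) < d + 1 := by omega
  simp only [x, hj, dif_neg, not_false_eq_true, Nat.add_sub_cancel_left, Nat.mod_eq_of_lt j.2]

/-- A stationary law whose last letter is uniform given the preceding ones is constant. -/
lemma IsStationaryLaw.eq_of_forall_snoc_eq [Nonempty Q] {p : (Fin (d + 1) → Q) → ℝ}
    (hp : IsStationaryLaw p) (h : ∀ (u : Fin d → Q) (a b : Q), p (Fin.snoc u a) = p (Fin.snoc u b))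
    (v w : Fin (d + 1) → Q) : p v = p w := by
  have hq : (Fintype.card Q : ℝ) ≠ 0 := by simp
  have hp' : ∀ w, prefixLaw p (Fin.init w) = Fintype.card Q * p w := by
    intro w
    rw [prefixLaw, Finset.sum_congr rfl fun a _ => h (Fin.init w) a (w (Fin.last d)),
      Fin.snoc_init_self]
    simp
  -- Words may differ only in their last `j` letters. Stationarity trades the last letter for a
  -- prepended one, which lengthens the agreeing initial segment by one.
  have key : ∀ j, j ≤ d + 1 → ∀ v w : Fin (d + 1) → Q,
      (∀ i : Fin (d + 1), (i : ℕ) + j < d + 1 → v i = w i) → p v = p w := by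
    intro j
    induction j with
    | zero =>
      intro _ v w hvw
      congr 1
      ext i
      exact hvw i i.2
    | succ j ih =>
      intro hj v w hvw
      apply mul_left_cancel₀ hq
      rw [← hp', ← hp', hp.prefixLaw_eq, hp.prefixLaw_eq]
      refine Finset.sum_congr rfl fun a _ => ih (by omega) _ _ fun i => ?_
      refine Fin.cases (fun _ => rfl) (fun i hi => ?_) i
      simp only [Fin.cons_succ, Fin.init]
      apply hvw
      simp only [Fin.val_succ, Fin.val_castSucc] at hi ⊢
      omega
  exact key (d + 1) le_rfl v w fun i hi => by omega

end StationaryLaws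

/-! ### Product laws of small block entropy. -/

section ProductLaws

variable {Q : Type*}

/-- The weight of a word under the product measure with letter weights `π`. -/
def iidLaw (π : Q → ℝ) {m : ℕ} (w : Fin m → Q) : ℝ := ∏ i, π (w i)

lemma iidLaw_snoc (π : Q → ℝ) {m : ℕ} (u : Fin m → Q) (a : Q) :
    iidLaw π (Fin.snoc u a : Fin (m + 1) → Q) = iidLaw π u * π a := by
  simp [iidLaw, Fin.prod_univ_castSucc]

lemma iidLaw_cons (π : Q → ℝ) {m : ℕ} (u : Fin m → Q) (a : Q) :
    iidLaw π (Fin.cons a u : Fin (m + 1) → Q) = π a * iidLaw π u := by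
  simp [iidLaw, Fin.prod_univ_succ]

lemma iidLaw_nonneg {π : Q → ℝ} (hπ : ∀ a, 0 ≤ π a) {m : ℕ} (w : Fin m → Q) : 0 ≤ iidLaw π w :=
  Finset.prod_nonneg fun i _ => hπ (w i)

lemma iidLaw_pos {π : Q → ℝ} (hπ : ∀ a, 0 < π a) {m : ℕ} (w : Fin m → Q) : 0 < iidLaw π w :=
  Finset.prod_pos fun i _ => hπ (w i)

variable [Fintype Q]

lemma sum_iidLaw {π : Q → ℝ} (hπ : ∑ a, π a = 1) (m : ℕ) : ∑ w : Fin m → Q, iidLaw π w = 1 := by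
  simp only [iidLaw]
  rw [← Fintype.sum_pow, hπ, one_pow]

lemma isStationaryLaw_iidLaw {π : Q → ℝ} (h0 : ∀ a, 0 ≤ π a) (h1 : ∑ a, π a = 1) (d : ℕ) :
    IsStationaryLaw (fun w : Fin (d + 1) → Q => iidLaw π w) where
  nonneg := iidLaw_nonneg h0
  sum_eq_one := sum_iidLaw h1 _
  prefixLaw_eq u := by
    simp only [prefixLaw, iidLaw_snoc, iidLaw_cons, ← Finset.mul_sum, ← Finset.sum_mul, h1]
    ring

lemma rate_iidLaw {π : Q → ℝ} (h1 : ∑ a, π a = 1) (d : ℕ) :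
    rate (fun w : Fin (d + 1) → Q => iidLaw π w) = homEntropy π := by
  simp only [rate, iidLaw_snoc, homEntropy_mul, ← Finset.sum_mul, sum_iidLaw h1, one_mul]

/-- A point mass has block entropy zero; by continuity a slight perturbation towards the uniform
weights keeps the entropy below `ε` and makes all weights positive. -/
lemma exists_pos_homEntropy_iidLaw_le [Nonempty Q] (k : ℕ) {ε : ℝ} (hε : 0 < ε) :
    ∃ π : Q → ℝ, (∀ a, 0 < π a) ∧ ∑ a, π a = 1 ∧
      homEntropy (fun w : Fin k → Q => iidLaw π w) ≤ ε := by
  classical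
  obtain ⟨b⟩ := ‹Nonempty Q›
  have hq : (Fintype.card Q : ℝ) ≠ 0 := by
    have : Nonempty Q := ⟨b⟩
    simp
  have hqpos : (0 : ℝ) < Fintype.card Q := lt_of_le_of_ne (Nat.cast_nonneg _) hq.symm
  let π : ℝ → Q → ℝ := fun η a => (1 - η) * (if a = b then 1 else 0) + η * (Fintype.card Q : ℝ)⁻¹
  have hsum : ∀ η, ∑ a, π η a = 1 := by
    intro η
    simp only [π, Finset.sum_add_distrib, ← Finset.mul_sum, Finset.sum_ite_eq', Finset.mem_univ,
      if_true, Finset.sum_const, Finset.card_univ, nsmul_eq_mul]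
    field_simp
    ring
  have hcont : Continuous fun η => homEntropy (fun w : Fin k → Q => iidLaw (π η) w) := by
    refine continuous_homEntropy.comp (continuous_pi fun w => ?_)
    simp only [iidLaw, π]
    fun_prop
  have hzero : homEntropy (fun w : Fin k → Q => iidLaw (π 0) w) = 0 := by
    rw [homEntropy, sum_iidLaw (hsum 0), Real.negMulLog_one, sub_zero]
    refine Finset.sum_eq_zero fun w _ => ?_
    by_cases hw : ∀ i, w i = b
    · simp [iidLaw, π, hw]
    · push Not at hw
      obtain ⟨i, hi⟩ := hw
      have : iidLaw (π 0) w = 0 := Finset.prod_eq_zero (Finset.mem_univ i) (by simp [π, hi])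
      rw [this, Real.negMulLog_zero]
  have hev : ∀ᶠ η in 𝓝[>] (0 : ℝ), homEntropy (fun w : Fin k → Q => iidLaw (π η) w) < ε :=
    (hcont.tendsto 0).mono_left nhdsWithin_le_nhds |>.eventually_lt_const (by rwa [hzero])
  have h1 : ∀ᶠ η in 𝓝[>] (0 : ℝ), η < 1 :=
    mem_nhdsWithin_of_mem_nhds (Iio_mem_nhds one_pos)
  obtain ⟨η, hη, hη1, hη0⟩ := (hev.and (h1.and self_mem_nhdsWithin)).exists
  refine ⟨π η, fun a => ?_, hsum η, hη.le⟩
  have hη0 : 0 < η := hη0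
  have : 0 ≤ (1 - η) * (if a = b then (1 : ℝ) else 0) :=
    mul_nonneg (by linarith) (by split_ifs <;> norm_num)
  have : 0 < η * (Fintype.card Q : ℝ)⁻¹ := by positivity
  simp only [π]
  linarith

end ProductLaws

/-! ### The finite-dimensional problem and its strict monotonicity. -/

section Feasible

variable {Q : Type*} {d k l : ℕ}

/-- The concatenation `αγβ`. -/
def glue (h : d + 1 = l + k + l) (α β : Fin l → Q) (γ : Fin k → Q) : Fin (d + 1) → Q :=
  Fin.append (Fin.append α γ) β ∘ Fin.cast h

lemma iidLaw_glue (h : d + 1 = l + k + l) (π : Q → ℝ) (α β : Fin l → Q) (γ : Fin k → Q) :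
    iidLaw π (glue h α β γ) = iidLaw π α * iidLaw π β * iidLaw π γ := by
  have : iidLaw π (glue h α β γ) = iidLaw π (Fin.append (Fin.append α γ) β) := by
    simp only [iidLaw, glue, Function.comp_apply]
    exact (finCongr h).prod_comp fun i => π (Fin.append (Fin.append α γ) β i)
  rw [this]
  simp only [iidLaw, Fin.prod_univ_add, Fin.append_left, Fin.append_right]
  ring

variable [Fintype Q]

/-- Stationary laws of words for which, given the outer blocks of length `l`, the middle block has
entropy at most `ε` nats. -/
structure IsFeasible (h : d + 1 = l + k + l) (ε : ℝ) (p : (Fin (d + 1) → Q) → ℝ) : Prop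
    extends IsStationaryLaw p where
  homEntropy_le : ∀ α β : Fin l → Q,
    homEntropy (fun γ => p (glue h α β γ)) ≤ ε * ∑ γ, p (glue h α β γ)

/-- In homogeneous form the entropy constraint compares continuous functions of `p`, null outer
pairs included, so it cuts a closed subset out of the simplex. -/
lemma isCompact_isFeasible (h : d + 1 = l + k + l) (ε : ℝ) :
    IsCompact {p : (Fin (d + 1) → Q) → ℝ | IsFeasible h ε p} := by
  have : {p : (Fin (d + 1) → Q) → ℝ | IsFeasible h ε p} = {p | IsStationaryLaw p} ∩
      {p | ∀ α β : Fin l → Q,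
        homEntropy (fun γ => p (glue h α β γ)) ≤ ε * ∑ γ, p (glue h α β γ)} := by
    ext p
    exact ⟨fun h => ⟨h.1, h.2⟩, fun h => ⟨h.1, h.2⟩⟩
  rw [this]
  refine (isCompact_stdSimplex ℝ (Fin (d + 1) → Q)).of_isClosed_subset
    (isClosed_isStationaryLaw.inter ?_) fun p hp => ⟨hp.1.nonneg, hp.1.sum_eq_one⟩
  simp only [Set.ofPred_forall]
  refine isClosed_iInter fun α => isClosed_iInter fun β => isClosed_le ?_ (by fun_prop)
  exact continuous_homEntropy.comp (by fun_prop)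

/-- The middle block is independent of the outer ones, whose weights factor out by homogeneity. -/
lemma isFeasible_iidLaw (h : d + 1 = l + k + l) {ε : ℝ} {π : Q → ℝ} (h0 : ∀ a, 0 ≤ π a)
    (h1 : ∑ a, π a = 1) (hπ : homEntropy (fun w : Fin k → Q => iidLaw π w) ≤ ε) :
    IsFeasible h ε (fun w => iidLaw π w) where
  toIsStationaryLaw := isStationaryLaw_iidLaw h0 h1 d
  homEntropy_le α β := by
    simp only [iidLaw_glue, homEntropy_mul, ← Finset.mul_sum, sum_iidLaw h1, mul_one]
    rw [mul_comm ε]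
    exact mul_le_mul_of_nonneg_left hπ (mul_nonneg (iidLaw_nonneg h0 α) (iidLaw_nonneg h0 β))

lemma exists_isFeasible_pos [Nonempty Q] (h : d + 1 = l + k + l) {ε : ℝ} (hε : 0 < ε) :
    ∃ r : (Fin (d + 1) → Q) → ℝ, IsFeasible h ε r ∧ ∀ w, 0 < r w := by
  obtain ⟨π, h0, h1, hπ⟩ := exists_pos_homEntropy_iidLaw_le (Q := Q) k hε
  exact ⟨_, isFeasible_iidLaw h (fun a => (h0 a).le) h1 hπ, iidLaw_pos h0⟩

/-- On a pair of positive mass the constraint is strict at `δ = 0`, since `ε₂ < ε₁`, and persists by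
continuity. On a null pair the mixture is `δ r`, and homogeneity reduces the constraint to that on
`r`. -/
lemma eventually_isFeasible_mix (h : d + 1 = l + k + l) {ε₁ ε₂ : ℝ} (hlt : ε₂ < ε₁)
    {p r : (Fin (d + 1) → Q) → ℝ} (hp : IsFeasible h ε₂ p) (hr : IsStationaryLaw r)
    (hrp : ∀ α β : Fin l → Q, ∑ γ, p (glue h α β γ) = 0 →
      homEntropy (fun γ => r (glue h α β γ)) ≤ ε₁ * ∑ γ, r (glue h α β γ)) :
    ∀ᶠ δ in 𝓝[>] (0 : ℝ), IsFeasible h ε₁ (mix δ p r) := by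
  have hone : ∀ᶠ δ in 𝓝[>] (0 : ℝ), δ < 1 :=
    mem_nhdsWithin_of_mem_nhds (Iio_mem_nhds one_pos)
  have hmain : ∀ᶠ δ in 𝓝[>] (0 : ℝ), ∀ α β : Fin l → Q,
      homEntropy (fun γ => mix δ p r (glue h α β γ)) ≤ ε₁ * ∑ γ, mix δ p r (glue h α β γ) := by
    simp only [eventually_all]
    intro α β
    have hnn : ∀ γ, 0 ≤ p (glue h α β γ) := fun γ => hp.nonneg _
    by_cases h0 : ∑ γ, p (glue h α β γ) = 0
    · filter_upwards [self_mem_nhdsWithin] with δ hδ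
      have hz : ∀ γ, p (glue h α β γ) = 0 := by
        simpa using (Finset.sum_eq_zero_iff_of_nonneg fun γ _ => hnn γ).1 h0
      simp only [mix, hz, mul_zero, zero_add, homEntropy_mul, ← Finset.mul_sum]
      have := mul_le_mul_of_nonneg_left (hrp α β h0) (le_of_lt hδ)
      linarith
    · have hpos : 0 < ∑ γ, p (glue h α β γ) :=
        lt_of_le_of_ne (Finset.sum_nonneg fun γ _ => hnn γ) (Ne.symm h0)
      have hc1 : Continuous fun δ : ℝ => homEntropy (fun γ => mix δ p r (glue h α β γ)) :=
        continuous_homEntropy.comp (by unfold mix; fun_prop)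
      have hc2 : Continuous fun δ : ℝ => ε₁ * ∑ γ, mix δ p r (glue h α β γ) := by
        unfold mix
        fun_prop
      have hlt0 : homEntropy (fun γ => mix 0 p r (glue h α β γ))
          < ε₁ * ∑ γ, mix 0 p r (glue h α β γ) := by
        simp only [mix, sub_zero, one_mul, zero_mul, add_zero]
        exact (hp.homEntropy_le α β).trans_lt (mul_lt_mul_of_pos_right hlt hpos)
      have := hc1.continuousAt.eventually_lt hc2.continuousAt hlt0
      exact (this.filter_mono nhdsWithin_le_nhds).mono fun _ h => h.le
  filter_upwards [hone, hmain, self_mem_nhdsWithin] with δ h1 h2 h0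
  exact ⟨hp.toIsStationaryLaw.mix hr (le_of_lt h0) h1.le, h2⟩

lemma exists_isFeasible_rate_lt [Nontrivial Q] (h : d + 1 = l + k + l) {ε₁ ε₂ : ℝ}
    (hε₁ : 0 < ε₁) (hlt : ε₂ < ε₁) (hk : ε₂ < k * Real.log (Fintype.card Q))
    {p : (Fin (d + 1) → Q) → ℝ} (hp : IsFeasible h ε₂ p) :
    ∃ p' : (Fin (d + 1) → Q) → ℝ, IsFeasible h ε₁ p' ∧ rate p < rate p' := by
  by_cases hsupp : ∃ w, p w = 0 ∧ 0 < prefixLaw p (Fin.init w)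
  · obtain ⟨w, hw, hpre⟩ := hsupp
    obtain ⟨r, hr, hrpos⟩ := exists_isFeasible_pos (Q := Q) h hε₁
    obtain ⟨δ, h1, h2⟩ :=
      ((eventually_isFeasible_mix h hlt hp hr.toIsStationaryLaw fun α β _ =>
        hr.homEntropy_le α β).and
        (eventually_rate_lt_rate_mix hp.nonneg hr.nonneg hw hpre (hrpos w))).exists
    exact ⟨_, h1, h2⟩
  -- No forbidden continuation remains, so `p` has full support and the condition on null pairs is
  -- void: the uniform law may be mixed in although it need not be feasible.
  push Not at hsupp
  have hpos : ∀ w, 0 < p w := hp.toIsStationaryLaw.pos fun w hw =>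
    lt_of_le_of_ne (hp.nonneg w) fun h0 => absurd hw (hsupp w h0.symm).not_gt
  -- Otherwise `p` is constant and its middle block has entropy `k log q`, contrary to `hk`.
  have hne : ∃ (u : Fin d → Q) (a b : Q), p (Fin.snoc u a) ≠ p (Fin.snoc u b) := by
    by_contra! hall
    have hconst := hp.toIsStationaryLaw.eq_of_forall_snoc_eq hall
    obtain ⟨a⟩ : Nonempty Q := inferInstance
    have hle := hp.homEntropy_le (fun _ => a) (fun _ => a)
    rw [show (fun γ : Fin k → Q => p (glue h (fun _ => a) (fun _ => a) γ)) =
      fun _ => p fun _ => a from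
      funext fun γ => hconst _ _, homEntropy_const, mul_comm] at hle
    have hS : 0 < ∑ _γ : Fin k → Q, p fun _ => a := Finset.sum_pos (fun _ _ => hpos _)
      Finset.univ_nonempty
    have := le_of_mul_le_mul_right hle hS
    rw [Fintype.card_fun, Fintype.card_fin, Nat.cast_pow, Real.log_pow] at this
    linarith
  obtain ⟨u, a, b, hab⟩ := hne
  have hrate : rate p < Real.log (Fintype.card Q) := by
    calc rate p < ∑ u : Fin d → Q, (∑ a, p (Fin.snoc u a)) * Real.log (Fintype.card Q) :=
          Finset.sum_lt_sum (fun u _ => homEntropy_le fun a => hp.nonneg _)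
            ⟨u, Finset.mem_univ u, homEntropy_lt (fun a => hp.nonneg _) hab⟩
      _ = _ := by rw [← Finset.sum_mul, ← sum_word_snoc, hp.sum_eq_one, one_mul]
  have hq : (Fintype.card Q : ℝ) ≠ 0 := by simp
  let π : Q → ℝ := fun _ => (Fintype.card Q : ℝ)⁻¹
  have hπ0 : ∀ a, 0 ≤ π a := fun a => by positivity
  have hπ1 : ∑ a, π a = 1 := by simp [π]
  have hr := isStationaryLaw_iidLaw hπ0 hπ1 d
  have hrr : rate (fun w : Fin (d + 1) → Q => iidLaw π w) = Real.log (Fintype.card Q) := by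
    rw [rate_iidLaw hπ1, homEntropy_const]
    change (∑ a, π a) * _ = _
    rw [hπ1, one_mul]
  have hone : ∀ᶠ δ in 𝓝[>] (0 : ℝ), δ < 1 :=
    mem_nhdsWithin_of_mem_nhds (Iio_mem_nhds one_pos)
  obtain ⟨δ, h1, h2, h0⟩ := ((eventually_isFeasible_mix h hlt hp hr fun α β h0 =>
    absurd h0 (Finset.sum_pos (fun _ _ => hpos _) Finset.univ_nonempty).ne').and
    (hone.and self_mem_nhdsWithin)).exists
  have h0 : 0 < δ := h0
  refine ⟨_, h1, lt_of_lt_of_le ?_ (rate_mix_ge hp.nonneg hr.nonneg h0 h2)⟩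
  rw [hrr]
  nlinarith

end Feasible

/-! ### Splitting a window into outer and middle blocks. -/

section Window

variable {Q : Type*} {d k l : ℕ}

lemma window_eq_glue_iff (h : d + 1 = l + k + l) (α β : Fin l → Q) (γ : Fin k → Q) (x : ℤ → Q) :
    window 0 (d + 1) x = glue h α β γ ↔
      (window 0 l x = α ∧ window ((l : ℤ) + k) l x = β) ∧ window (l : ℤ) k x = γ := by
  have h1 : window 0 (d + 1) x = glue h α β γ ↔
      window 0 (l + k + l) x = Fin.append (Fin.append α γ) β := by
    constructor
    · intro hx
      ext i
      simpa [glue, window] using congrFun hx (Fin.cast h.symm i)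
    · intro hx
      ext i
      simpa [glue, window] using congrFun hx (Fin.cast h i)
  have h2 : window 0 (l + k + l) x =
      Fin.append (Fin.append (window 0 l x) (window l k x)) (window ((l : ℤ) + k) l x) := by
    ext i
    refine Fin.addCases (fun i => ?_) (fun i => ?_) i
    · refine Fin.addCases (fun i => ?_) (fun i => ?_) i <;> simp [window]
    · simp [window]
  have h3 : ∀ {m n : ℕ} (a a' : Fin m → Q) (b b' : Fin n → Q),
      Fin.append a b = Fin.append a' b' ↔ a = a' ∧ b = b' := fun a a' b b' =>
    ((Fin.appendEquiv (α := Q) _ _).injective.eq_iff (a := (a, b)) (b := (a', b'))).trans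
      Prod.mk_inj
  rw [h1, h2, h3, h3, and_right_comm]

end Window

/-! ### Word laws of a measure: entropy and recoverability. -/

section WordLaw

variable {Q : Type*} [MeasurableSpace Q]

/-- The probability `μ(X_0 … X_{m-1} = w)`. -/
def wordLaw (μ : Measure (ℤ → Q)) (m : ℕ) (w : Fin m → Q) : ℝ := μ.real (window 0 m ⁻¹' {w})

lemma measurable_window (a : ℤ) (m : ℕ) : Measurable (window (Q := Q) a m) :=
  measurable_pi_lambda _ fun _ => measurable_pi_apply _

lemma measurable_shift : Measurable (shift (Q := Q)) :=
  measurable_pi_lambda _ fun _ => measurable_pi_apply _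

lemma measurableSet_window [MeasurableSingletonClass Q] (a : ℤ) (m : ℕ) (w : Fin m → Q) :
    MeasurableSet (window a m ⁻¹' {w}) :=
  measurable_window a m (measurableSet_singleton w)

variable [Fintype Q] [MeasurableSingletonClass Q]

lemma sum_measureReal_inter_preimage {Ω A : Type*} [MeasurableSpace Ω] [Fintype A]
    [MeasurableSpace A] [MeasurableSingletonClass A] (μ : Measure Ω) [IsFiniteMeasure μ]
    {f : Ω → A} (hf : Measurable f) {E : Set Ω} :
    ∑ a, μ.real (E ∩ f ⁻¹' {a}) = μ.real E := by
  have := sum_measureReal_preimage_singleton (μ := μ.restrict E) (f := f) Finset.univ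
    fun a _ => hf (measurableSet_singleton a)
  simp only [measureReal_restrict_apply (hf (measurableSet_singleton _)), Finset.coe_univ,
    Set.preimage_univ, measureReal_restrict_apply MeasurableSet.univ, Set.univ_inter] at this
  simpa only [Set.inter_comm] using this

lemma sum_wordLaw_snoc (μ : Measure (ℤ → Q)) [IsFiniteMeasure μ] {m : ℕ} (u : Fin m → Q) :
    ∑ a, wordLaw μ (m + 1) (Fin.snoc u a) = wordLaw μ m u := by
  rw [wordLaw, ← sum_measureReal_inter_preimage μ (measurable_pi_apply (m : ℤ))]
  refine Finset.sum_congr rfl fun a _ => ?_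
  unfold wordLaw
  congr 1
  ext x
  simp only [Set.mem_preimage, Set.mem_singleton_iff, Set.mem_inter_iff, funext_iff,
    Fin.forall_fin_succ', Fin.snoc_castSucc, Fin.snoc_last, window, Fin.val_castSucc, Fin.val_last,
    zero_add]

lemma sum_wordLaw_cons {μ : Measure (ℤ → Q)} [IsFiniteMeasure μ] (hμ : MeasurePreserving shift μ μ)
    {m : ℕ} (u : Fin m → Q) : ∑ a, wordLaw μ (m + 1) (Fin.cons a u) = wordLaw μ m u := by
  rw [wordLaw, ← hμ.measureReal_preimage (measurableSet_window 0 m u).nullMeasurableSet,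
    ← sum_measureReal_inter_preimage μ (measurable_pi_apply (0 : ℤ))]
  refine Finset.sum_congr rfl fun a _ => ?_
  unfold wordLaw
  congr 1
  ext x
  simp only [Set.mem_preimage, Set.mem_singleton_iff, Set.mem_inter_iff, funext_iff,
    Fin.forall_fin_succ, Fin.cons_zero, Fin.cons_succ, window, Fin.val_zero, Fin.val_succ, shift,
    zero_add, Nat.cast_zero, Nat.cast_add, Nat.cast_one]
  exact and_comm

lemma sum_wordLaw (μ : Measure (ℤ → Q)) [IsProbabilityMeasure μ] (m : ℕ) :
    ∑ w, wordLaw μ m w = 1 := by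
  have := sum_measureReal_inter_preimage μ (measurable_window (Q := Q) 0 m) (E := Set.univ)
  simpa [wordLaw] using this

lemma isStationaryLaw_wordLaw {μ : Measure (ℤ → Q)} [IsProbabilityMeasure μ]
    (hμ : MeasurePreserving shift μ μ) (d : ℕ) : IsStationaryLaw (wordLaw μ (d + 1)) where
  nonneg _ := measureReal_nonneg
  sum_eq_one := sum_wordLaw μ _
  prefixLaw_eq u := (sum_wordLaw_snoc μ u).trans (sum_wordLaw_cons hμ u).symm

lemma shannonEntropy_eq {A : Type*} [Fintype A] [MeasurableSpace A] (b : ℝ) (ν : Measure A) :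
    shannonEntropy b ν = (∑ a, Real.negMulLog (ν.real {a})) / Real.log b := by
  simp only [shannonEntropy, Real.logb, Real.negMulLog, Finset.sum_div, ← Finset.sum_neg_distrib]
  exact Finset.sum_congr rfl fun a _ => by ring

lemma blockEntropy_eq (μ : Measure (ℤ → Q)) (m : ℕ) :
    blockEntropy μ m = (∑ w, Real.negMulLog (wordLaw μ m w)) / Real.log (Fintype.card Q) := by
  simp only [blockEntropy, shannonEntropy_eq, wordLaw,
    map_measureReal_apply (measurable_window 0 m) (measurableSet_singleton _)]

/-- The chain rule, adding one letter at a time on the right. -/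
lemma sum_negMulLog_wordLaw (μ : Measure (ℤ → Q)) [IsProbabilityMeasure μ] (m : ℕ) :
    ∑ w, Real.negMulLog (wordLaw μ m w) = ∑ i ∈ Finset.range m, rate (wordLaw μ (i + 1)) := by
  induction m with
  | zero =>
    have h := sum_wordLaw μ 0
    rw [Fintype.sum_unique] at h
    rw [Fintype.sum_unique, h]
    simp
  | succ m ih =>
    rw [Finset.sum_range_succ, ← ih, rate]
    simp only [homEntropy, Finset.sum_sub_distrib, sum_wordLaw_snoc]
    rw [sum_word_snoc]
    ring

/-- A longer past adds a letter on the left, and conditioning on it reduces entropy; shift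
invariance identifies the merged law with the shorter word law. -/
lemma antitone_rate_wordLaw {μ : Measure (ℤ → Q)} [IsProbabilityMeasure μ]
    (hμ : MeasurePreserving shift μ μ) : Antitone fun m => rate (wordLaw μ (m + 1)) := by
  refine antitone_nat_of_succ_le fun m => ?_
  rw [rate, sum_word_cons]
  refine Finset.sum_le_sum fun v _ => ?_
  refine (sum_homEntropy_le _ fun b a => measureReal_nonneg).trans_eq ?_
  congr 1
  ext a
  simp only [← Fin.cons_snoc_eq_snoc_cons]
  exact sum_wordLaw_cons hμ _

/-- By the chain rule, block entropy over length is a Cesàro mean of the rates. -/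
lemma entropy_eq_of_tendsto {μ : Measure (ℤ → Q)} [IsProbabilityMeasure μ] {L : ℝ}
    (h : Tendsto (fun m => rate (wordLaw μ (m + 1))) atTop (𝓝 L)) :
    entropy μ = L / Real.log (Fintype.card Q) := by
  refine Tendsto.limUnder_eq ?_
  refine (h.cesaro.div_const _).congr fun m => ?_
  rw [blockEntropy_eq, sum_negMulLog_wordLaw, div_right_comm, div_eq_inv_mul _ (m : ℝ)]

lemma entropy_le_rate [Nontrivial Q] {μ : Measure (ℤ → Q)} [IsProbabilityMeasure μ]
    (hμ : MeasurePreserving shift μ μ) (d : ℕ) :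
    entropy μ ≤ rate (wordLaw μ (d + 1)) / Real.log (Fintype.card Q) := by
  have hbdd : BddBelow (Set.range fun m => rate (wordLaw μ (m + 1))) := by
    refine ⟨0, ?_⟩
    rintro _ ⟨m, rfl⟩
    exact Finset.sum_nonneg fun u _ => homEntropy_nonneg fun a => measureReal_nonneg
  rw [entropy_eq_of_tendsto (tendsto_atTop_ciInf (antitone_rate_wordLaw hμ) hbdd)]
  have : 0 ≤ Real.log (Fintype.card Q) := Real.log_natCast_nonneg _
  exact div_le_div_of_nonneg_right (ciInf_le hbdd d) this

variable {d k l : ℕ}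

lemma condEntropy_eq (h : d + 1 = l + k + l) (μ : Measure (ℤ → Q)) [IsProbabilityMeasure μ]
    (α β : Fin l → Q) :
    condEntropy μ k l α β = (∑ γ, wordLaw μ (d + 1) (glue h α β γ))⁻¹ *
      homEntropy (fun γ => wordLaw μ (d + 1) (glue h α β γ)) / Real.log (Fintype.card Q) := by
  set E : Set (ℤ → Q) := {x | window 0 l x = α ∧ window ((l : ℤ) + k) l x = β}
  have hE : MeasurableSet E :=
    (measurableSet_window 0 l α).inter (measurableSet_window _ l β)
  have hglue : ∀ γ, window 0 (d + 1) ⁻¹' {glue h α β γ} = E ∩ window (l : ℤ) k ⁻¹' {γ} := by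
    intro γ
    ext x
    exact window_eq_glue_iff h α β γ x
  have hsum : ∑ γ, wordLaw μ (d + 1) (glue h α β γ) = μ.real E := by
    simp only [wordLaw, hglue]
    exact sum_measureReal_inter_preimage μ (measurable_window _ _)
  have hlaw : ∀ γ, ((ProbabilityTheory.cond μ E).map (window (l : ℤ) k)).real {γ}
      = (μ.real E)⁻¹ * wordLaw μ (d + 1) (glue h α β γ) := by
    intro γ
    rw [map_measureReal_apply (measurable_window _ _) (measurableSet_singleton _), wordLaw, hglue,
      measureReal_def, ProbabilityTheory.cond_apply hE, ENNReal.toReal_mul, ENNReal.toReal_inv]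
    rfl
  rw [condEntropy, shannonEntropy_eq]
  change (∑ γ, Real.negMulLog
    (((ProbabilityTheory.cond μ E).map (window (l : ℤ) k)).real {γ})) / _ = _
  simp only [hlaw]
  congr 1
  rw [← homEntropy_mul, homEntropy, ← Finset.mul_sum, hsum]
  by_cases h0 : μ.real E = 0
  · simp [h0]
  · rw [inv_mul_cancel₀ h0, Real.negMulLog_one, sub_zero]

lemma condEntropy_le_iff [Nontrivial Q] (h : d + 1 = l + k + l) {ε : ℝ} (hε : 0 ≤ ε)
    (μ : Measure (ℤ → Q)) [IsProbabilityMeasure μ] (α β : Fin l → Q) :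
    condEntropy μ k l α β ≤ ε ↔ homEntropy (fun γ => wordLaw μ (d + 1) (glue h α β γ))
      ≤ ε * Real.log (Fintype.card Q) * ∑ γ, wordLaw μ (d + 1) (glue h α β γ) := by
  have hq : 0 < Real.log (Fintype.card Q) :=
    Real.log_pos (by exact_mod_cast Fintype.one_lt_card)
  have hnn : ∀ γ, 0 ≤ wordLaw μ (d + 1) (glue h α β γ) := fun γ => measureReal_nonneg
  rw [condEntropy_eq h, div_le_iff₀ hq]
  rcases (Finset.sum_nonneg fun γ (_ : γ ∈ Finset.univ) => hnn γ).eq_or_lt with h0 | hpos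
  -- For a null pair both sides hold: the left reads `0 ≤ ε log q`, which needs `0 ≤ ε`, and the
  -- right reads `0 ≤ 0`.
  · have hz : ∀ γ, wordLaw μ (d + 1) (glue h α β γ) = 0 := by
      simpa using (Finset.sum_eq_zero_iff_of_nonneg fun γ _ => hnn γ).1 h0.symm
    simp only [hz, homEntropy, Finset.sum_const_zero, Real.negMulLog_zero, sub_zero, mul_zero,
      le_refl, iff_true]
    positivity
  · rw [inv_mul_le_iff₀ hpos, mul_comm]

lemma isRecoverable_iff [Nontrivial Q] (h : d + 1 = l + k + l) {ε : ℝ} (hε : 0 ≤ ε)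
    (μ : Measure (ℤ → Q)) [hprob : IsProbabilityMeasure μ] (hμ : MeasurePreserving shift μ μ) :
    IsRecoverable ε k l μ ↔
      IsFeasible h (ε * Real.log (Fintype.card Q)) (wordLaw μ (d + 1)) :=
  ⟨fun H => ⟨isStationaryLaw_wordLaw hμ d, fun α β =>
      (condEntropy_le_iff h hε μ α β).1 (H.condEntropy_le α β)⟩,
    fun H => ⟨hprob, hμ, fun α β => (condEntropy_le_iff h hε μ α β).2 (H.homEntropy_le α β)⟩⟩

end WordLaw

/-! ### From consistent word laws to a shift-invariant measure. -/

section Extension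

variable {Q : Type*}

/-- Extension of a word to a bi-infinite sequence by the constant `q₀`. -/
def extend (q₀ : Q) {m : ℕ} (w : Fin m → Q) (j : ℤ) : Q :=
  if h : 0 ≤ j ∧ j.toNat < m then w ⟨j.toNat, h.2⟩ else q₀

lemma extend_natCast (q₀ : Q) {m : ℕ} (w : Fin m → Q) {j : ℕ} (hj : j < m) :
    extend q₀ w j = w ⟨j, hj⟩ := by
  simp [extend, hj]

lemma window_zero_extend (q₀ : Q) {m : ℕ} (w : Fin m → Q) : window 0 m (extend q₀ w) = w := by
  ext i
  simp [window, extend_natCast q₀ w i.2]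

lemma window_extend_init (q₀ : Q) {i m n : ℕ} (h : i + m ≤ n) (w : Fin (n + 1) → Q) :
    window i m (extend q₀ w) = window i m (extend q₀ (Fin.init w)) := by
  ext j
  have hj := j.2
  simp only [window, ← Nat.cast_add]
  rw [extend_natCast q₀ w (by omega), extend_natCast q₀ (Fin.init w) (by omega)]
  rfl

lemma window_extend_tail (q₀ : Q) {i m n : ℕ} (h : i + m ≤ n) (w : Fin (n + 1) → Q) :
    window ((i + 1 : ℕ) : ℤ) m (extend q₀ w) = window i m (extend q₀ (Fin.tail w)) := by
  ext j
  have hj := j.2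
  simp only [window, ← Nat.cast_add]
  rw [extend_natCast q₀ w (by omega), extend_natCast q₀ (Fin.tail w) (by omega)]
  simp only [Fin.tail, Fin.succ_mk]
  congr 2
  omega

lemma window_comp_add (x : ℤ → Q) (a b : ℤ) (m : ℕ) :
    window a m (fun j => x (j + b)) = window (a + b) m x := by
  ext i
  simp only [window]
  congr 1
  ring

variable [Fintype Q]

/-- A consistent stationary family of laws of words of length at least `d`. -/
structure IsConsistent (d : ℕ) (R : ∀ m : ℕ, (Fin (d + m) → Q) → ℝ) : Prop where
  nonneg : ∀ m w, 0 ≤ R m w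
  sum_eq_one : ∑ w, R 0 w = 1
  sum_snoc : ∀ m (w : Fin (d + m) → Q), ∑ a, R (m + 1) (Fin.snoc (α := fun _ => Q) w a) = R m w
  sum_cons : ∀ m (w : Fin (d + m) → Q), ∑ a, R (m + 1) (Fin.cons (α := fun _ => Q) a w) = R m w

lemma IsConsistent.sum_eq_one' {d : ℕ} {R : ∀ m : ℕ, (Fin (d + m) → Q) → ℝ}
    (hR : IsConsistent d R) (m : ℕ) : ∑ w, R m w = 1 := by
  induction m with
  | zero => exact hR.sum_eq_one
  | succ m ih =>
    rw [← ih]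
    refine (sum_word_snoc (m := d + m) (R (m + 1))).trans ?_
    exact Finset.sum_congr rfl fun w _ => hR.sum_snoc m w

variable [MeasurableSpace Q] [MeasurableSingletonClass Q]

lemma ext_of_map_window [Nonempty Q] {μ ν : Measure (ℤ → Q)} [IsFiniteMeasure μ] (d : ℕ)
    (h : ∀ (a : ℤ) (m : ℕ), μ.map (window a (d + m)) = ν.map (window a (d + m))) : μ = ν := by
  obtain ⟨q₀⟩ := ‹Nonempty Q›
  have hT : ∀ (a : ℤ) (m : ℕ) (T : Set (Fin (d + m) → Q)),
      μ (window a (d + m) ⁻¹' T) = ν (window a (d + m) ⁻¹' T) := by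
    intro a m T
    rw [← Measure.map_apply (measurable_window _ _) T.toFinite.measurableSet, h,
      Measure.map_apply (measurable_window _ _) T.toFinite.measurableSet]
  refine ext_of_generate_finite _ (generateFrom_measurableCylinders).symm
    isPiSystem_measurableCylinders (fun s hs => ?_) (hT 0 0 Set.univ)
  obtain ⟨I, S, -, rfl⟩ := (mem_measurableCylinders _).1 hs
  obtain ⟨N, hN⟩ : ∃ N : ℕ, ∀ i ∈ I, i.natAbs < N :=
    ⟨(I.sup Int.natAbs) + 1, fun i hi => Nat.lt_succ_of_le (Finset.le_sup (f := Int.natAbs) hi)⟩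
  -- Coordinates in `I` lie strictly between `-N` and `N`, hence inside the window starting at `-N`;
  -- `extend` turns a window back into a sequence with the same values there.
  have : cylinder I S = window (-(N : ℤ)) (d + 2 * N) ⁻¹'
      {w | (fun j => extend q₀ w (j + N)) ∈ cylinder I S} := by
    ext x
    simp only [mem_cylinder, Set.mem_preimage, Set.mem_ofPred_eq]
    congr! 1
    ext ⟨i, hi⟩
    have := hN i hi
    obtain ⟨n, hn⟩ : ∃ n : ℕ, i + N = n := ⟨(i + N).toNat, by omega⟩
    simp only [Finset.restrict]
    rw [hn, extend_natCast q₀ _ (show n < d + 2 * N by omega), window]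
    congr 1
    simp only
    omega
  rw [this]
  exact hT _ _ _

/-- The measure on a finite set with the given weights. -/
def weightMeasure {A : Type*} [Fintype A] [MeasurableSpace A] (f : A → ℝ) : Measure A :=
  ∑ a, ENNReal.ofReal (f a) • Measure.dirac a

instance {A : Type*} [Fintype A] [MeasurableSpace A] (f : A → ℝ) :
    IsFiniteMeasure (weightMeasure f) := by
  constructor
  simp only [weightMeasure, Measure.coe_finsetSum, Finset.sum_apply, Measure.smul_apply,
    measure_univ, smul_eq_mul, mul_one]
  exact ENNReal.sum_lt_top.2 fun a _ => ENNReal.ofReal_lt_top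

lemma weightMeasure_real_singleton {A : Type*} [Fintype A] [MeasurableSpace A]
    [MeasurableSingletonClass A] {f : A → ℝ} (hf : ∀ a, 0 ≤ f a) (a : A) :
    (weightMeasure f).real {a} = f a := by
  classical
  simp only [measureReal_def, weightMeasure, Measure.coe_finsetSum, Finset.sum_apply,
    Measure.smul_apply, smul_eq_mul, Measure.dirac_apply' _ (measurableSet_singleton a)]
  rw [Finset.sum_eq_single a]
  · simp [hf a]
  · intro b _ hb
    simp [hb]
  · simp

lemma ext_of_real_singleton {A : Type*} [Fintype A] [MeasurableSpace A]
    [MeasurableSingletonClass A] {μ ν : Measure A} [IsFiniteMeasure μ] [IsFiniteMeasure ν]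
    (h : ∀ a, μ.real {a} = ν.real {a}) : μ = ν :=
  Measure.ext_of_singleton fun a => (measureReal_eq_measureReal_iff).1 (h a)

namespace IsConsistent

variable {d : ℕ} {R : ∀ m : ℕ, (Fin (d + m) → Q) → ℝ}

lemma map_init (hR : IsConsistent d R) (m : ℕ) :
    (weightMeasure (R (m + 1))).map (Fin.init (α := fun _ => Q)) = weightMeasure (R m) := by
  have hmeas : Measurable (Fin.init (α := fun _ => Q) : (Fin (d + m + 1) → Q) → Fin (d + m) → Q) :=
    measurable_of_countable _
  refine ext_of_real_singleton fun u => ?_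
  rw [map_measureReal_apply hmeas (measurableSet_singleton u),
    weightMeasure_real_singleton (hR.nonneg m), ← hR.sum_snoc,
    ← sum_measureReal_inter_preimage _ (measurable_pi_apply (Fin.last (d + m)))]
  refine Finset.sum_congr rfl fun a _ => ?_
  rw [← weightMeasure_real_singleton (hR.nonneg (m + 1))]
  congr 1
  ext x
  simp only [Set.mem_inter_iff, Set.mem_preimage, Set.mem_singleton_iff]
  constructor
  · rintro ⟨rfl, rfl⟩
    exact (Fin.snoc_init_self (α := fun _ => Q) x).symm
  · rintro rfl
    exact ⟨Fin.init_snoc (α := fun _ => Q) a u, Fin.snoc_last (α := fun _ => Q) a u⟩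

lemma map_tail (hR : IsConsistent d R) (m : ℕ) :
    (weightMeasure (R (m + 1))).map (Fin.tail (α := fun _ => Q)) = weightMeasure (R m) := by
  have hmeas : Measurable (Fin.tail (α := fun _ => Q) : (Fin (d + m + 1) → Q) → Fin (d + m) → Q) :=
    measurable_of_countable _
  refine ext_of_real_singleton fun u => ?_
  rw [map_measureReal_apply hmeas (measurableSet_singleton u),
    weightMeasure_real_singleton (hR.nonneg m), ← hR.sum_cons,
    ← sum_measureReal_inter_preimage _ (measurable_pi_apply (0 : Fin (d + m + 1)))]
  refine Finset.sum_congr rfl fun a _ => ?_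
  rw [← weightMeasure_real_singleton (hR.nonneg (m + 1))]
  congr 1
  ext x
  simp only [Set.mem_inter_iff, Set.mem_preimage, Set.mem_singleton_iff]
  constructor
  · rintro ⟨rfl, rfl⟩
    exact (Fin.cons_self_tail (α := fun _ => Q) x).symm
  · rintro rfl
    exact ⟨rfl, rfl⟩

lemma isProbabilityMeasure (hR : IsConsistent d R) (m : ℕ) :
    IsProbabilityMeasure (weightMeasure (R m)) := by
  constructor
  simp only [weightMeasure, Measure.coe_finsetSum, Finset.sum_apply, Measure.smul_apply,
    measure_univ, smul_eq_mul, mul_one]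
  rw [← ENNReal.ofReal_sum_of_nonneg fun w _ => hR.nonneg m w, hR.sum_eq_one', ENNReal.ofReal_one]

/-- Induction on the length: a window missing the last letter survives `Fin.init`; one reaching it
but missing the first survives `Fin.tail`; the remaining window is the whole word. -/
lemma map_window_extend (hR : IsConsistent d R) (q₀ : Q) (n : ℕ) :
    ∀ i m : ℕ, i + m ≤ n → (weightMeasure (R n)).map
      (fun w => window i (d + m) (extend q₀ w)) = weightMeasure (R m) := by
  induction n with
  | zero =>
    intro i m h
    obtain rfl : i = 0 := by omega
    obtain rfl : m = 0 := by omega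
    simp only [Nat.cast_zero, window_zero_extend]
    exact Measure.map_id
  | succ n ih =>
    intro i m h
    by_cases hle : i + m ≤ n
    · rw [← ih i m hle, ← hR.map_init n,
        Measure.map_map (measurable_of_countable _) (measurable_of_countable _)]
      congr 1
      ext1 w
      exact window_extend_init q₀ (show i + (d + m) ≤ d + n by omega) w
    · rcases i with _ | i
      · obtain rfl : m = n + 1 := by omega
        simp only [Nat.cast_zero, window_zero_extend]
        exact Measure.map_id
      · rw [← ih i m (by omega), ← hR.map_tail n,
          Measure.map_map (measurable_of_countable _) (measurable_of_countable _)]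
        congr 1
        ext1 w
        exact window_extend_tail q₀ (show i + (d + m) ≤ d + n by omega) w

/-- Kolmogorov extension: a limit of finite approximations along an ultrafilter. -/
lemma exists_measure [Nonempty Q] (hR : IsConsistent d R) :
    ∃ μ : Measure (ℤ → Q), IsProbabilityMeasure μ ∧
      ∀ (a : ℤ) (m : ℕ), μ.map (window a (d + m)) = weightMeasure (R m) := by
  obtain ⟨q₀⟩ := ‹Nonempty Q›
  let _ : TopologicalSpace Q := ⊥
  have : DiscreteTopology Q := ⟨rfl⟩
  have : BorelSpace Q := by
    constructor
    rw [borel_eq_top_of_discrete]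
    exact eq_top_iff.2 fun s _ => s.toFinite.measurableSet
  have hmeas : ∀ N : ℕ, Measurable fun (w : Fin (d + 2 * N) → Q) (j : ℤ) => extend q₀ w (j + N) :=
    fun N => measurable_of_countable _
  have := hR.isProbabilityMeasure
  -- The law of words of length `d + 2 N` is placed from position `-N` on, so that any fixed window
  -- is eventually covered.
  let μs : ℕ → ProbabilityMeasure (ℤ → Q) := fun N =>
    ⟨(weightMeasure (R (2 * N))).map fun w j => extend q₀ w (j + N),
      Measure.isProbabilityMeasure_map (hmeas N).aemeasurable⟩
  obtain ⟨μ, -, hμ⟩ := isCompact_univ.ultrafilter_le_nhds ((hyperfilter ℕ).map μs)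
    (by simp)
  have hlim : Tendsto μs (hyperfilter ℕ) (𝓝 μ) := hμ
  refine ⟨μ, inferInstance, fun a m => ext_of_real_singleton fun x => ?_⟩
  rw [map_measureReal_apply (measurable_window _ _) (measurableSet_singleton x)]
  -- Cylinders are clopen, so their measures pass to the weak limit; along the approximations they
  -- are eventually constant.
  have hclopen : IsClopen (window a (d + m) ⁻¹' {x}) :=
    (isClopen_discrete {x}).preimage (by unfold window; fun_prop)
  have ht := ProbabilityMeasure.tendsto_measure_of_isClopen_of_tendsto hlim hclopen
  have hev : ∀ᶠ N in (hyperfilter ℕ : Filter ℕ),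
      (μs N (window a (d + m) ⁻¹' {x}) : ℝ) = (weightMeasure (R m)).real {x} := by
    refine Nat.hyperfilter_le_atTop ?_
    filter_upwards [eventually_ge_atTop (a.natAbs + m)] with N hN
    obtain ⟨i, hi⟩ : ∃ i : ℕ, a + N = i := ⟨(a + N).toNat, by omega⟩
    have hmap := hR.map_window_extend q₀ (2 * N) i m (by omega)
    change ((weightMeasure (R (2 * N))).map fun w j => extend q₀ w (j + N)).real _ = _
    rw [map_measureReal_apply (hmeas N) (measurableSet_window _ _ _), ← hmap,
      map_measureReal_apply (measurable_of_countable _) (measurableSet_singleton x)]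
    congr 1
    ext w
    simp only [Set.mem_preimage, window_comp_add, hi]
  have ht' := (NNReal.continuous_coe.tendsto _).comp ht
  exact tendsto_nhds_unique ht' (tendsto_const_nhds.congr' (hev.mono fun N h => h.symm))

/-- Invariance holds because the window laws do not depend on the position of the window. -/
lemma exists_measurePreserving [Nonempty Q] (hR : IsConsistent d R) :
    ∃ μ : Measure (ℤ → Q), IsProbabilityMeasure μ ∧ MeasurePreserving shift μ μ ∧
      ∀ m, wordLaw μ (d + m) = R m := by
  obtain ⟨μ, hprob, hμ⟩ := hR.exists_measure
  refine ⟨μ, hprob, ⟨measurable_shift, ?_⟩, fun m => ?_⟩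
  · have := Measure.isFiniteMeasure_map μ (shift (Q := Q))
    refine ext_of_map_window d fun a m => ?_
    rw [Measure.map_map (measurable_window _ _) measurable_shift, hμ, ← hμ (a + 1) m]
    congr 1
    ext1 x
    exact window_comp_add x a 1 _
  · ext w
    rw [← weightMeasure_real_singleton (hR.nonneg m) w, ← hμ 0 m,
      map_measureReal_apply (measurable_window _ _) (measurableSet_singleton w)]
    rfl

end IsConsistent

end Extension

/-! ### The `d`-step Markov measure of a stationary law. -/

section Markov

variable {Q : Type*} {d : ℕ}

/-- The last `d + 1` letters of a word of length `d + (m + 1)`. -/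
def suffix (d m : ℕ) (w : Fin (d + (m + 1)) → Q) : Fin (d + 1) → Q :=
  fun i => w ⟨m + i, by omega⟩

/-- The last `d` letters of a word of length `d + m`. -/
def shortSuffix (d m : ℕ) (w : Fin (d + m) → Q) : Fin d → Q := fun i => w ⟨m + i, by omega⟩

lemma suffix_snoc (m : ℕ) (w : Fin (d + m) → Q) (a : Q) :
    suffix d m (Fin.snoc (α := fun _ => Q) w a) = Fin.snoc (shortSuffix d m w) a := by
  ext i
  refine Fin.lastCases ?_ (fun i => ?_) i
  · simp [suffix, Fin.snoc, Nat.add_comm m d]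
  · have hi := i.2
    simp [suffix, shortSuffix, Fin.snoc, show m + (i : ℕ) < d + m by omega]

lemma suffix_cons (m : ℕ) (w : Fin (d + (m + 1)) → Q) (a : Q) :
    suffix d (m + 1) (Fin.cons (α := fun _ => Q) a w) = suffix d m w := by
  ext i
  simp only [suffix, Nat.add_right_comm m 1]
  rfl

lemma suffix_zero (w : Fin (d + (0 + 1)) → Q) : suffix d 0 w = w := by
  ext i
  simp only [suffix, zero_add]

lemma suffix_eq_cons (m : ℕ) (w : Fin (d + (m + 1)) → Q) :
    suffix d m w = Fin.cons (w ⟨m, by omega⟩) (shortSuffix d (m + 1) w) := by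
  ext i
  refine Fin.cases ?_ (fun i => ?_) i
  · simp [suffix]
  · simp only [suffix, shortSuffix, Fin.cons_succ, Fin.val_succ]
    congr 2
    omega

variable [Fintype Q]

/-- Conditional probability of the last letter given the preceding ones. -/
def transition (p : (Fin (d + 1) → Q) → ℝ) (w : Fin (d + 1) → Q) : ℝ :=
  p w / prefixLaw p (Fin.init w)

/-- The laws of words of length `d + m` for the `d`-step Markov chain with transitions `p`. -/
def markovLaw (p : (Fin (d + 1) → Q) → ℝ) : ∀ m : ℕ, (Fin (d + m) → Q) → ℝ
  | 0, w => prefixLaw p w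
  | m + 1, w => markovLaw p m (Fin.init (α := fun _ => Q) w) * transition p (suffix d m w)

lemma markovLaw_snoc (p : (Fin (d + 1) → Q) → ℝ) (m : ℕ) (w : Fin (d + m) → Q) (a : Q) :
    markovLaw p (m + 1) (Fin.snoc (α := fun _ => Q) w a) =
      markovLaw p m w * transition p (Fin.snoc (shortSuffix d m w) a) := by
  rw [markovLaw, suffix_snoc, Fin.init_snoc]

variable {p : (Fin (d + 1) → Q) → ℝ}

namespace IsStationaryLaw

lemma prefixLaw_nonneg (hp : IsStationaryLaw p) (u : Fin d → Q) : 0 ≤ prefixLaw p u :=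
  Finset.sum_nonneg fun _ _ => hp.nonneg _

lemma prefixLaw_mul_transition (hp : IsStationaryLaw p) (w : Fin (d + 1) → Q) :
    prefixLaw p (Fin.init w) * transition p w = p w := by
  by_cases h : prefixLaw p (Fin.init w) = 0
  · rw [h, zero_mul]
    exact le_antisymm (hp.nonneg w) (h ▸ le_prefixLaw hp.nonneg w)
  · exact mul_div_cancel₀ _ h

lemma markovLaw_one (hp : IsStationaryLaw p) : markovLaw p 1 = p := by
  ext w
  rw [markovLaw, suffix_zero, markovLaw]
  exact hp.prefixLaw_mul_transition w

lemma markovLaw_nonneg (hp : IsStationaryLaw p) (m : ℕ) (w : Fin (d + m) → Q) :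
    0 ≤ markovLaw p m w := by
  induction m with
  | zero => exact hp.prefixLaw_nonneg w
  | succ m ih => exact mul_nonneg (ih _) (div_nonneg (hp.nonneg _) (hp.prefixLaw_nonneg _))

/-- After a null suffix the transitions are `0` by the convention for division and do not sum to
one; this shows that such words carry no mass. -/
lemma markovLaw_eq_zero (hp : IsStationaryLaw p) (m : ℕ) (w : Fin (d + m) → Q)
    (h : prefixLaw p (shortSuffix d m w) = 0) : markovLaw p m w = 0 := by
  rcases m with _ | m
  · have : shortSuffix d 0 w = w := by
      ext i
      simp only [shortSuffix, zero_add]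
      rfl
    rwa [this] at h
  · rw [hp.prefixLaw_eq] at h
    have := (Finset.sum_eq_zero_iff_of_nonneg fun a _ => hp.nonneg _).1 h
      (w ⟨m, by omega⟩) (Finset.mem_univ _)
    rw [markovLaw, transition, suffix_eq_cons, this, zero_div, mul_zero]

lemma sum_markovLaw_snoc (hp : IsStationaryLaw p) (m : ℕ) (w : Fin (d + m) → Q) :
    ∑ a, markovLaw p (m + 1) (Fin.snoc (α := fun _ => Q) w a) = markovLaw p m w := by
  simp only [markovLaw_snoc, ← Finset.mul_sum, transition, Fin.init_snoc, ← Finset.sum_div]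
  change markovLaw p m w * (prefixLaw p _ / prefixLaw p _) = _
  by_cases h : prefixLaw p (shortSuffix d m w) = 0
  · rw [hp.markovLaw_eq_zero m w h, zero_mul]
  · rw [div_self h, mul_one]

lemma markovLaw_cons_succ (p : (Fin (d + 1) → Q) → ℝ) (m : ℕ) (w : Fin (d + (m + 1)) → Q) (a : Q) :
    markovLaw p (m + 2) (Fin.cons (α := fun _ => Q) a w) =
      markovLaw p (m + 1) (Fin.cons (α := fun _ => Q) a (Fin.init (α := fun _ => Q) w)) *
        transition p (suffix d m w) := by
  rw [markovLaw, suffix_cons]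
  congr 2
  ext i
  refine Fin.cases rfl (fun i => rfl) i

/-- The base case is equality of the two marginals of `p`. Later transitions see only the last `d`
letters, so the prepended letter sums out before them. -/
lemma sum_markovLaw_cons (hp : IsStationaryLaw p) (m : ℕ) (w : Fin (d + m) → Q) :
    ∑ a, markovLaw p (m + 1) (Fin.cons (α := fun _ => Q) a w) = markovLaw p m w := by
  induction m with
  | zero =>
    rw [hp.markovLaw_one]
    exact (hp.prefixLaw_eq w).symm
  | succ m ih =>
    simp only [markovLaw_cons_succ, ← Finset.sum_mul]
    rw [ih]
    rfl

lemma isConsistent_markovLaw (hp : IsStationaryLaw p) : IsConsistent d (markovLaw p) where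
  nonneg := hp.markovLaw_nonneg
  sum_eq_one := by
    rw [← hp.sum_eq_one, sum_word_snoc]
    rfl
  sum_snoc := hp.sum_markovLaw_snoc
  sum_cons := hp.sum_markovLaw_cons

/-- The next letter depends only on the last `d` letters, so letters further back factor out of the
conditional entropy by homogeneity and sum out. -/
lemma rate_markovLaw (hp : IsStationaryLaw p) (m : ℕ) :
    rate (d := d + m) (markovLaw p (m + 1)) = rate p := by
  induction m with
  | zero => exact congrArg rate hp.markovLaw_one
  | succ m ih =>
    rw [← ih, rate]
    refine (sum_word_cons (m := d + m) _).trans ?_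
    refine Finset.sum_congr rfl fun v _ => ?_
    have h : ∀ b a, markovLaw p (m + 2)
        (Fin.snoc (α := fun _ => Q) (Fin.cons (α := fun _ => Q) b v) a) =
        markovLaw p (m + 1) (Fin.cons (α := fun _ => Q) b v) *
          transition p (Fin.snoc (shortSuffix d m v) a) := by
      intro b a
      have := markovLaw_cons_succ p m (Fin.snoc (α := fun _ => Q) v a) b
      rwa [suffix_snoc, Fin.init_snoc, Fin.cons_snoc_eq_snoc_cons] at this
    calc _ = ∑ b, markovLaw p (m + 1) (Fin.cons (α := fun _ => Q) b v) *
          homEntropy fun a => transition p (Fin.snoc (shortSuffix d m v) a) :=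
          Finset.sum_congr rfl fun b _ => by
            rw [← homEntropy_mul]
            exact congrArg homEntropy (funext (h b))
      _ = _ := by
        rw [← Finset.sum_mul, hp.sum_markovLaw_cons, ← homEntropy_mul]
        exact congrArg homEntropy (funext fun a => (markovLaw_snoc p m v a).symm)

/-- The rates of the Markov measure are constant from index `d` on, so its entropy attains the bound
of `entropy_le_rate`. -/
lemma exists_measure [Nonempty Q] [MeasurableSpace Q] [MeasurableSingletonClass Q]
    (hp : IsStationaryLaw p) :
    ∃ μ : Measure (ℤ → Q), IsProbabilityMeasure μ ∧ MeasurePreserving shift μ μ ∧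
      wordLaw μ (d + 1) = p ∧ entropy μ = rate p / Real.log (Fintype.card Q) := by
  obtain ⟨μ, hprob, hμ, hlaw⟩ := hp.isConsistent_markovLaw.exists_measurePreserving
  refine ⟨μ, hprob, hμ, (hlaw 1).trans hp.markovLaw_one, entropy_eq_of_tendsto ?_⟩
  refine tendsto_const_nhds.congr' ?_
  filter_upwards [eventually_ge_atTop d] with j hj
  obtain ⟨m, rfl⟩ := Nat.exists_eq_add_of_le hj
  rw [← hp.rate_markovLaw m, ← hlaw (m + 1)]
  rfl

end IsStationaryLaw

end Markov

/-! ### Reduction of the maximal entropy to finite dimension. -/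

section MaxEntropy

variable {Q : Type*} [Fintype Q] [Nontrivial Q] [MeasurableSpace Q] [MeasurableSingletonClass Q]
  {d k l : ℕ}

/-- The maximal entropy is the maximum of the finite-dimensional problem. -/
lemma exists_isFeasible_isGreatest (h : d + 1 = l + k + l) {ε : ℝ} (hε : 0 < ε) :
    ∃ p : (Fin (d + 1) → Q) → ℝ, IsFeasible h (ε * Real.log (Fintype.card Q)) p ∧
      (∀ r : (Fin (d + 1) → Q) → ℝ, IsFeasible h (ε * Real.log (Fintype.card Q)) r → rate r ≤ rate p) ∧
      IsGreatest (entropyValues Q ε k l) (rate p / Real.log (Fintype.card Q)) := by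
  have hq : 0 < Real.log (Fintype.card Q) :=
    Real.log_pos (by exact_mod_cast Fintype.one_lt_card)
  obtain ⟨r, hr, -⟩ := exists_isFeasible_pos (Q := Q) h (mul_pos hε hq)
  obtain ⟨p, hp, hmax⟩ := (isCompact_isFeasible h _).exists_isMaxOn ⟨r, hr⟩
    continuous_rate.continuousOn
  refine ⟨p, hp, fun r hr => hmax hr, ?_, ?_⟩
  · obtain ⟨μ, hprob, hμ, hlaw, hent⟩ := IsStationaryLaw.exists_measure hp.toIsStationaryLaw
    exact ⟨μ, (isRecoverable_iff h hε.le μ hμ).2 (hlaw ▸ hp), hent⟩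
  · rintro _ ⟨μ, hμ, rfl⟩
    have := hμ.isProbabilityMeasure
    refine (entropy_le_rate hμ.shiftInvariant d).trans ?_
    exact div_le_div_of_nonneg_right
      (hmax ((isRecoverable_iff h hε.le μ hμ.shiftInvariant).1 hμ)) hq.le

end MaxEntropy

end RecSys

end

theorem mainTheorem10 (Q : Type*) [Fintype Q] [Nontrivial Q] [MeasurableSpace Q]
    [MeasurableSingletonClass Q] (k l : ℕ) (hk : 1 ≤ k) (hl : 1 ≤ l) (ε₁ ε₂ : ℝ)
    (hε₂ : 0 < ε₂) (hlt : ε₂ < ε₁) (hε₂k : ε₂ < k) :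
    IsGreatest (RecSys.entropyValues Q ε₁ k l) (RecSys.maxEntropy Q ε₁ k l) ∧
    IsGreatest (RecSys.entropyValues Q ε₂ k l) (RecSys.maxEntropy Q ε₂ k l) ∧
    RecSys.maxEntropy Q ε₁ k l > RecSys.maxEntropy Q ε₂ k l := by
  have hq : 0 < Real.log (Fintype.card Q) :=
    Real.log_pos (by exact_mod_cast Fintype.one_lt_card)
  obtain ⟨d, hd⟩ : ∃ d, d + 1 = l + k + l := ⟨l + k + l - 1, by omega⟩
  have hε₁ : 0 < ε₁ := hε₂.trans hlt
  obtain ⟨p₁, -, hmax₁, hgr₁⟩ := RecSys.exists_isFeasible_isGreatest (Q := Q) hd hε₁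
  obtain ⟨p₂, hp₂, -, hgr₂⟩ := RecSys.exists_isFeasible_isGreatest (Q := Q) hd hε₂
  -- The factor `log q` converts the bounds from base `q` to nats; `ε₂ < k` becomes `ε₂ log q < k
  -- log q`.
  obtain ⟨r, hr, hlt_r⟩ := RecSys.exists_isFeasible_rate_lt hd (mul_pos hε₁ hq)
    (mul_lt_mul_of_pos_right hlt hq) (mul_lt_mul_of_pos_right hε₂k hq) hp₂
  rw [RecSys.maxEntropy, RecSys.maxEntropy, hgr₁.csSup_eq, hgr₂.csSup_eq]
  exact ⟨hgr₁, hgr₂, div_lt_div_of_pos_right (hlt_r.trans_le (hmax₁ r hr)) hq⟩
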